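/- Let $d,n\ge 1$. For $\phi\in\mathcal S(\mathbb R^m)$ (complex-valued) let $\mathcal F\phi(\xi)=\int_{\mathbb R^m}e^{-i\xi\cdot x}\phi(x)\,dx$, and for $T\in\mathcal S'(\mathbb R^m)$ let $(\mathcal FT,\phi)=(T,\mathcal F\phi)$. For $t>0$ let $G(t,\cdot)\in\mathcal S'(\mathbb R^d)$ be the fundamental solution of the wave operator $\partial_t^2-\Delta$ (that is, $\partial_t^2G=\Delta G$, $G(0,\cdot)=0$, $\partial_tG(0,\cdot)=\delta_0$), whose Fourier transform is the function $\mathcal FG(t,\cdot)(\xi)=\sin(t|\xi|)/|\xi|$ (equal to $t$ at $\xi=0$). For $\psi\in\mathcal S(\mathbb R^d)$ and $T\in\mathcal S'(\mathbb R^d)$ let $(\psi*T)(x)=(T,\psi(x-\cdot))$. For $\phi_1,\dots,\phi_n\in\mathcal S(\mathbb R^d)$ and $s_1,\dots,s_n\in\mathbb R$ define recursively $\varphi_0=1$ and, for $1\le k\le n$, $$\psi_k(s_1,\dots,s_{k-1},\cdot)=\phi_k(\cdot)\,\varphi_{k-1}(s_1,\dots,s_{k-1},\cdot),\qquad \varphi_k(s_1,\dots,s_k,\cdot)=\psi_k(s_1,\dots,s_{k-1},\cdot)*G(s_k,\cdot).$$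 Let $0<t_1<\dots<t_n<t$ and $x\in\mathbb R^d$, and put $t_{n+1}=t$. We say that $f_n=f_n(t_1,\cdot,\dots,t_n,\cdot,t,x)\in\mathcal S'(\mathbb R^{nd})$ is the kernel distribution if for all $\phi_1,\dots,\phi_n\in\mathcal S(\mathbb R^d)$ $$(f_n,\phi_1\otimes\dots\otimes\phi_n)=\varphi_n(t_2-t_1,t_3-t_2,\dots,t-t_n,x).$$ Let $$K(\xi_1,\dots,\xi_n)=e^{-i(\xi_1+\dots+\xi_n)\cdot x}\prod_{j=1}^n\overline{\mathcal FG(t_{j+1}-t_j,\cdot)(\xi_1+\dots+\xi_j)}.$$ Then: (1) such an $f_n\in\mathcal S'(\mathbb R^{nd})$ exists, with Fourier transform the function $K$: for every $H\in\mathcal S(\mathbb R^{nd})$ the function $HK$ is integrable and $(\mathcal Ff_n,H)=\int_{\mathbb R^{nd}}H(\xi)K(\xi)\,d\xi$; (2) for every $f_n\in\mathcal S'(\mathbb R^{nd})$ with the above action on tensor products, and for every $h=h_1\otimes\dots\otimes h_n$ with $h_i\in C_0^\infty(\mathbb R^d)$, $$(\mathcal F f_n(t_1,\cdot,\dots,t_n,\cdot,t,x),h)=\int_{\mathbb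 R^{nd}}h(\xi_1,\dots,\xi_n)\,K(\xi_1,\dots,\xi_n)\,d\xi_1\cdots d\xi_n.$$ -/

import Mathlib

open MeasureTheory FourierTransform SchwartzMap Laplacian
open scoped ComplexConjugate ContDiff

noncomputable section

namespace StochWave

/-! ### The Fourier transform `φ ↦ ∫ e^{-i ξ·x} φ(x) dx` on `𝓢` and `𝓢'` -/

section Dilation

variable {V : Type*} [NormedAddCommGroup V] [InnerProductSpace ℝ V]

variable (V) in
/-- The dilation `x ↦ 2π x`. -/
def dilation : V ≃L[ℝ] V :=
  ContinuousLinearEquiv.smulLeft (Units.mk0 (2 * Real.pi) (by positivity))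

theorem dilation_apply (x : V) : dilation V x = (2 * Real.pi) • x := rfl

theorem dilation_symm_apply (x : V) : (dilation V).symm x = (2 * Real.pi)⁻¹ • x := rfl

end Dilation

section Fourier

variable (V : Type*) [NormedAddCommGroup V] [InnerProductSpace ℝ V] [FiniteDimensional ℝ V]
  [MeasurableSpace V] [BorelSpace V]

/-- The Fourier transform on Schwartz functions, normalized as
`ξ ↦ ∫ e^{-i ξ·x} φ(x) dx` (see `fourierS_apply`). -/
def fourierS : 𝓢(V, ℂ) →L[ℂ] 𝓢(V, ℂ) :=
  compCLMOfContinuousLinearEquiv ℂ (dilation V).symm ∘L fourierCLM ℂ 𝓢(V, ℂ)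

/-- The inverse of `fourierS`. -/
def fourierInvS : 𝓢(V, ℂ) →L[ℂ] 𝓢(V, ℂ) :=
  fourierInvCLM ℂ 𝓢(V, ℂ) ∘L compCLMOfContinuousLinearEquiv ℂ (dilation V)

variable {V}

theorem fourierS_apply (φ : 𝓢(V, ℂ)) (ξ : V) :
    fourierS V φ ξ = ∫ x, Complex.exp (-(Complex.I * (inner ℝ ξ x : ℝ))) * φ x := by
  change 𝓕 φ ((dilation V).symm ξ) = _
  rw [dilation_symm_apply, fourier_coe, Real.fourier_eq']
  congr 1
  ext x
  rw [real_inner_smul_right, real_inner_comm, smul_eq_mul]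
  congr 2
  have : (Real.pi : ℂ) ≠ 0 := by exact_mod_cast Real.pi_ne_zero
  push_cast
  field_simp

theorem fourierS_fourierInvS (φ : 𝓢(V, ℂ)) : fourierS V (fourierInvS V φ) = φ := by
  ext x
  change 𝓕 (𝓕⁻ (compCLMOfContinuousLinearEquiv ℂ (dilation V) φ)) ((dilation V).symm x) = _
  rw [fourier_fourierInv_eq, compCLMOfContinuousLinearEquiv_apply, Function.comp_apply,
    ContinuousLinearEquiv.apply_symm_apply]

theorem fourierInvS_fourierS (φ : 𝓢(V, ℂ)) : fourierInvS V (fourierS V φ) = φ := by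
  have : compCLMOfContinuousLinearEquiv ℂ (dilation V) (fourierS V φ) = 𝓕 φ := by
    ext x
    change 𝓕 φ ((dilation V).symm (dilation V x)) = _
    rw [ContinuousLinearEquiv.symm_apply_apply]
  change 𝓕⁻ (compCLMOfContinuousLinearEquiv ℂ (dilation V) (fourierS V φ)) = _
  rw [this, fourierInv_fourier_eq]

theorem fourierInvS_apply (φ : 𝓢(V, ℂ)) (ξ : V) :
    fourierInvS V φ ξ = ((2 * Real.pi) ^ Module.finrank ℝ V : ℝ)⁻¹ *
      ∫ x, Complex.exp (Complex.I * (inner ℝ ξ x : ℝ)) * φ x := by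
  change 𝓕⁻ (compCLMOfContinuousLinearEquiv ℂ (dilation V) φ) ξ = _
  rw [fourierInv_coe, Real.fourierInv_eq']
  have := Measure.integral_comp_smul (μ := (volume : Measure V))
    (fun x => Complex.exp (Complex.I * (inner ℝ ξ x : ℝ)) * φ x) (2 * Real.pi)
  rw [abs_of_pos (by positivity), Complex.real_smul] at this
  rw [← this]
  congr 1
  ext x
  rw [real_inner_smul_right, real_inner_comm, smul_eq_mul, compCLMOfContinuousLinearEquiv_apply]
  simp only [Function.comp_apply, dilation_apply]
  congr 2
  push_cast
  ring

/-- The Fourier transform of a tempered distribution, `(𝓕 T, φ) = (T, 𝓕 φ)`. -/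
def fourierDistrib (T : 𝓢'(V, ℂ)) : 𝓢'(V, ℂ) :=
  PointwiseConvergenceCLM.precomp ℂ (fourierS V) T

@[simp] theorem fourierDistrib_apply (T : 𝓢'(V, ℂ)) (φ : 𝓢(V, ℂ)) :
    fourierDistrib T φ = T (fourierS V φ) := rfl

theorem fourierInvS_laplacian (φ : 𝓢(V, ℂ)) (ξ : V) :
    fourierInvS V (Δ φ) ξ = -((‖ξ‖ ^ 2 : ℝ) : ℂ) * fourierInvS V φ ξ := by
  have key (ψ : 𝓢(V, ℂ)) : fourierInvS V ψ ξ =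
      ((2 * Real.pi) ^ Module.finrank ℝ V : ℝ)⁻¹ * 𝓕 ψ (-((2 * Real.pi)⁻¹ • ξ)) := by
    rw [fourierInvS_apply, fourier_coe, Real.fourier_eq']
    congr 2
    ext x
    rw [inner_neg_right, real_inner_smul_right, real_inner_comm, smul_eq_mul]
    congr 2
    have : (Real.pi : ℂ) ≠ 0 := by exact_mod_cast Real.pi_ne_zero
    push_cast
    field_simp
  rw [key, key, laplacian_eq_fourierMultiplierCLM, fourierMultiplierCLM_apply,
    FourierTransform.fourier_smul, fourier_fourierInv_eq]
  rw [_root_.smul_apply, smulLeftCLM_apply_apply (by fun_prop)]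
  rw [norm_neg, norm_smul, Complex.real_smul, Complex.real_smul]
  have : (Real.pi : ℂ) ≠ 0 := by exact_mod_cast Real.pi_ne_zero
  rw [Real.norm_of_nonneg (by positivity)]
  push_cast
  field_simp

end Fourier

/-! ### The fundamental solution of the wave operator -/

section Symbol

variable {V : Type*} [NormedAddCommGroup V]

/-- The function `ξ ↦ sin (t |ξ|) / |ξ|`, with its limit value `t` at `ξ = 0`. -/
def waveSymbol (t : ℝ) (ξ : V) : ℝ := t * Real.sinc (t * ‖ξ‖)

theorem waveSymbol_of_ne_zero (t : ℝ) {ξ : V} (hξ : ξ ≠ 0) :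
    waveSymbol t ξ = Real.sin (t * ‖ξ‖) / ‖ξ‖ := by
  have h : ‖ξ‖ ≠ 0 := norm_ne_zero_iff.2 hξ
  rcases eq_or_ne t 0 with rfl | ht
  · simp [waveSymbol]
  · rw [waveSymbol, Real.sinc_of_ne_zero (mul_ne_zero ht h)]
    field_simp

theorem waveSymbol_zero_right (t : ℝ) : waveSymbol t (0 : V) = t := by
  simp [waveSymbol]

theorem continuous_waveSymbol (t : ℝ) : Continuous (waveSymbol t : V → ℝ) := by
  unfold waveSymbol
  exact continuous_const.mul (Real.continuous_sinc.comp (continuous_const.mul continuous_norm))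

theorem abs_waveSymbol_le (t : ℝ) (ξ : V) : |waveSymbol t ξ| ≤ |t| := by
  rw [waveSymbol, abs_mul]
  exact mul_le_of_le_one_right (abs_nonneg _) (Real.abs_sinc_le_one _)

theorem hasDerivAt_waveSymbol (t : ℝ) (ξ : V) :
    HasDerivAt (fun s => waveSymbol s ξ) (Real.cos (t * ‖ξ‖)) t := by
  rcases eq_or_ne ξ 0 with rfl | hξ
  · simpa [waveSymbol] using hasDerivAt_id' t
  · have h : ‖ξ‖ ≠ 0 := norm_ne_zero_iff.2 hξ
    simp only [waveSymbol_of_ne_zero _ hξ]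
    have h1 := (((hasDerivAt_id t).mul_const ‖ξ‖).sin).div_const ‖ξ‖
    simpa [h] using h1

theorem hasDerivAt_cos_mul_norm (t : ℝ) (ξ : V) :
    HasDerivAt (fun s => Real.cos (s * ‖ξ‖)) (-‖ξ‖ ^ 2 * waveSymbol t ξ) t := by
  rcases eq_or_ne ξ 0 with rfl | hξ
  · simpa using hasDerivAt_const t (1 : ℝ)
  · have h : ‖ξ‖ ≠ 0 := norm_ne_zero_iff.2 hξ
    rw [waveSymbol_of_ne_zero _ hξ]
    convert ((hasDerivAt_id' t).mul_const ‖ξ‖).cos using 1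
    field_simp

end Symbol

section Translate

variable {V : Type*} [NormedAddCommGroup V] [NormedSpace ℝ V]

/-- The Schwartz function `y ↦ ψ (x - y)`. -/
def reflTranslate (ψ : 𝓢(V, ℂ)) (x : V) : 𝓢(V, ℂ) :=
  compCLMOfAntilipschitz ℂ (g := fun y => x - y) (K := 1) (by fun_prop)
    (fun _ _ => by simp) ψ

theorem reflTranslate_apply (ψ : 𝓢(V, ℂ)) (x y : V) : reflTranslate ψ x y = ψ (x - y) := rfl

end Translate

section Wave

variable {V : Type*} [NormedAddCommGroup V] [InnerProductSpace ℝ V] [FiniteDimensional ℝ V]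
  [MeasurableSpace V] [BorelSpace V]

theorem memLp_top_of_continuous_bounded {g : V → ℝ} (hg : Continuous g) {C : ℝ}
    (hC : ∀ ξ, |g ξ| ≤ C) : MemLp (fun ξ => (g ξ : ℂ)) ⊤ (volume : Measure V) :=
  memLp_top_of_bound (Complex.continuous_ofReal.comp hg).aestronglyMeasurable C
    (Filter.Eventually.of_forall fun ξ => by simpa using hC ξ)

/-- The tempered distribution whose Fourier transform is the bounded function `g`. -/
def invFourierOfBounded (g : V → ℂ) (hg : MemLp g ⊤ (volume : Measure V)) : 𝓢'(V, ℂ) :=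
  PointwiseConvergenceCLM.precomp ℂ (fourierInvS V) (Lp.toTemperedDistribution (hg.toLp g))

theorem invFourierOfBounded_apply (g : V → ℂ) (hg : MemLp g ⊤ (volume : Measure V))
    (φ : 𝓢(V, ℂ)) : invFourierOfBounded g hg φ = ∫ ξ, fourierInvS V φ ξ * g ξ := by
  change Lp.toTemperedDistribution (hg.toLp g) (fourierInvS V φ) = _
  rw [Lp.toTemperedDistribution_apply]
  apply integral_congr_ae
  filter_upwards [hg.coeFn_toLp] with ξ h
  rw [h, smul_eq_mul]

/-- The fundamental solution `G(t, ·)` of the wave operator `∂²/∂t² - Δ`, as a tempered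
distribution in the space variable. That it solves the Cauchy problem which characterizes the
fundamental solution is `waveKernel_cauchyProblem`; its Fourier transform is the function
`waveSymbol t` by `fourierDistrib_waveKernel`. -/
def waveKernel (t : ℝ) : 𝓢'(V, ℂ) :=
  invFourierOfBounded (fun ξ => (waveSymbol t ξ : ℂ))
    (memLp_top_of_continuous_bounded (continuous_waveSymbol t) (abs_waveSymbol_le t))

theorem waveKernel_apply (t : ℝ) (φ : 𝓢(V, ℂ)) :
    waveKernel t φ = ∫ ξ, fourierInvS V φ ξ * (waveSymbol t ξ : ℂ) :=
  invFourierOfBounded_apply _ _ _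

theorem fourierDistrib_waveKernel (t : ℝ) (h : 𝓢(V, ℂ)) :
    fourierDistrib (waveKernel t) h = ∫ ξ, h ξ * (waveSymbol t ξ : ℂ) := by
  rw [fourierDistrib_apply, waveKernel_apply, fourierInvS_fourierS]

theorem integrable_mul_bounded (φ : 𝓢(V, ℂ)) {g : V → ℝ} (hg : Continuous g) {C : ℝ}
    (hC : ∀ ξ, |g ξ| ≤ C) : Integrable (fun ξ => φ ξ * (g ξ : ℂ)) := by
  refine φ.integrable.mul_bdd (c := C) (Complex.continuous_ofReal.comp hg).aestronglyMeasurable ?_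
  exact Filter.Eventually.of_forall fun ξ => by simpa using hC ξ

/-- `G` solves `∂²G/∂t² = Δ G` with `G(0, ·) = 0` and `∂G/∂t(0, ·) = δ₀`, in `𝓢'`. -/
theorem waveKernel_cauchyProblem : ∃ G' : ℝ → 𝓢'(V, ℂ),
    (∀ t φ, HasDerivAt (fun s => waveKernel s φ) (G' t φ) t) ∧
    (∀ t φ, HasDerivAt (fun s => G' s φ) ((Δ (waveKernel t : 𝓢'(V, ℂ))) φ) t) ∧
    (waveKernel 0 : 𝓢'(V, ℂ)) = 0 ∧ G' 0 = TemperedDistribution.delta 0 := by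
  have hc (t : ℝ) : Continuous (fun ξ : V => Real.cos (t * ‖ξ‖)) := by fun_prop
  have hb (t : ℝ) (ξ : V) : |Real.cos (t * ‖ξ‖)| ≤ 1 := Real.abs_cos_le_one _
  refine ⟨fun t => invFourierOfBounded (fun ξ => (Real.cos (t * ‖ξ‖) : ℂ))
    (memLp_top_of_continuous_bounded (hc t) (hb t)), fun t φ => ?_, fun t φ => ?_, ?_, ?_⟩
  · simp only [waveKernel_apply, invFourierOfBounded_apply]
    refine (hasDerivAt_integral_of_dominated_loc_of_deriv_le (μ := volume)
      (F := fun s ξ => fourierInvS V φ ξ * (waveSymbol s ξ : ℂ))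
      (F' := fun s ξ => fourierInvS V φ ξ * (Real.cos (s * ‖ξ‖) : ℂ))
      (bound := fun ξ => ‖fourierInvS V φ ξ‖)
      Filter.univ_mem (Filter.Eventually.of_forall fun s => ?_) ?_ ?_
      (Filter.Eventually.of_forall fun ξ s _ => ?_) 
      ((fourierInvS V φ).integrable (μ := volume)).norm (Filter.Eventually.of_forall fun ξ s _ => ?_)).2
    · exact (integrable_mul_bounded _ (continuous_waveSymbol s)
        (abs_waveSymbol_le s)).aestronglyMeasurable
    · exact integrable_mul_bounded _ (continuous_waveSymbol t) (abs_waveSymbol_le t)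
    · exact (integrable_mul_bounded _ (hc t) (hb t)).aestronglyMeasurable
    · rw [norm_mul]
      exact mul_le_of_le_one_right (norm_nonneg _) (by rw [Complex.norm_real]; exact hb s ξ)
    · exact (hasDerivAt_waveSymbol s ξ).ofReal_comp.const_mul _
  · simp only [TemperedDistribution.laplacian_apply_apply, waveKernel_apply,
      invFourierOfBounded_apply, fourierInvS_laplacian]
    have hB : Integrable (fun ξ : V => (|t| + 1) * (‖ξ‖ ^ 2 * ‖fourierInvS V φ ξ‖)) :=
      ((fourierInvS V φ).integrable_pow_mul volume 2).const_mul _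
    refine (hasDerivAt_integral_of_dominated_loc_of_deriv_le (μ := volume)
      (F := fun s ξ => fourierInvS V φ ξ * (Real.cos (s * ‖ξ‖) : ℂ))
      (F' := fun s ξ => -((‖ξ‖ ^ 2 : ℝ) : ℂ) * fourierInvS V φ ξ * (waveSymbol s ξ : ℂ))
      (bound := fun ξ => (|t| + 1) * (‖ξ‖ ^ 2 * ‖fourierInvS V φ ξ‖))
      (Metric.ball_mem_nhds t one_pos) (Filter.Eventually.of_forall fun s => ?_) ?_ ?_
      (Filter.Eventually.of_forall fun ξ s hs => ?_) hB
      (Filter.Eventually.of_forall fun ξ s _ => ?_)).2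
    · exact (integrable_mul_bounded _ (hc s) (hb s)).aestronglyMeasurable
    · exact integrable_mul_bounded _ (hc t) (hb t)
    · refine Continuous.aestronglyMeasurable ?_
      have := continuous_waveSymbol (V := V) t
      have := (fourierInvS V φ).continuous
      fun_prop
    · rw [norm_mul, norm_mul, norm_neg, Complex.norm_real, Complex.norm_real, Real.norm_eq_abs,
        Real.norm_eq_abs, abs_of_nonneg (by positivity), mul_comm]
      have h1 : |s| ≤ |t| + 1 := by
        have h2 : |s - t| < 1 := by simpa [Real.dist_eq] using hs
        have h3 := abs_sub_abs_le_abs_sub s t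
        linarith
      gcongr
      exact (abs_waveSymbol_le s ξ).trans h1
    · refine ((hasDerivAt_cos_mul_norm s ξ).ofReal_comp.const_mul
        (fourierInvS V φ ξ)).congr_deriv ?_
      push_cast
      ring
  · ext φ
    simp [waveKernel_apply, waveSymbol]
  · ext φ
    rw [invFourierOfBounded_apply, TemperedDistribution.delta_apply]
    conv_rhs => rw [← fourierS_fourierInvS φ, fourierS_apply]
    simp

/-! ### Convolution with a tempered distribution and the kernels `f_n` -/

/-- The convolution `ψ * T` of a Schwartz function and a tempered distribution: the function
`x ↦ (T, ψ (x - ·))`. -/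
def conv (ψ : 𝓢(V, ℂ)) (T : 𝓢'(V, ℂ)) : V → ℂ := fun x => T (reflTranslate ψ x)

/-- The function `φ_n(s_1, …, s_n, ·)` obtained from the test functions `φ_1, …, φ_n` by
`φ_k(s_1, …, s_k, ·) = (φ_k · φ_{k-1}(s_1, …, s_{k-1}, ·)) * G(s_k, ·)`, starting from the
constant function `1`. The product is formed in the Schwartz space with `smulLeftCLM`, and is the
pointwise one by `iterConv_succ_factor`. -/
def iterConv : (n : ℕ) → (Fin n → ℝ) → (Fin n → 𝓢(V, ℂ)) → V → ℂ
  | 0, _, _ => fun _ => 1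
  | n + 1, s, φ =>
    conv (smulLeftCLM ℂ (iterConv n (fun j => s j.castSucc) (fun j => φ j.castSucc))
      (φ (Fin.last n))) (waveKernel (s (Fin.last n)))

theorem fourierInvS_reflTranslate (ψ : 𝓢(V, ℂ)) (x ξ : V) :
    fourierInvS V (reflTranslate ψ x) ξ =
      Complex.exp (Complex.I * (inner ℝ ξ x : ℝ)) * fourierInvS V ψ (-ξ) := by
  simp only [fourierInvS_apply, reflTranslate_apply]
  rw [← integral_sub_left_eq_self (fun y => Complex.exp (Complex.I * (inner ℝ ξ y : ℝ)) * ψ (x - y))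
    volume x, mul_left_comm, ← integral_const_mul (Complex.exp _)]
  congr 1
  refine integral_congr_ae (Filter.Eventually.of_forall fun y => ?_)
  beta_reduce
  rw [sub_sub_cancel, ← mul_assoc, ← Complex.exp_add, inner_sub_right, inner_neg_left]
  congr 2
  push_cast
  ring

/-- `ψ * G(t, ·)` is smooth, and each of its derivatives is bounded. -/
theorem conv_waveKernel_hasTemperateGrowth (ψ : 𝓢(V, ℂ)) (t : ℝ) :
    (conv ψ (waveKernel t)).HasTemperateGrowth := by
  set K : V → ℂ := fun ξ => fourierInvS V ψ ξ * (waveSymbol t ξ : ℂ) with hK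
  have hKc : Continuous K :=
    (fourierInvS V ψ).continuous.mul (Complex.continuous_ofReal.comp (continuous_waveSymbol t))
  have hint (k : ℕ) : Integrable (fun ξ => ‖ξ‖ ^ k * ‖K ξ‖) := by
    refine (((fourierInvS V ψ).integrable_pow_mul volume k).const_mul |t|).mono'
      (by fun_prop) (Filter.Eventually.of_forall fun ξ => ?_)
    rw [norm_mul, norm_norm, norm_pow, norm_norm, hK, norm_mul, Complex.norm_real]
    have := abs_waveSymbol_le t ξ
    rw [Real.norm_eq_abs]
    calc ‖ξ‖ ^ k * (‖fourierInvS V ψ ξ‖ * |waveSymbol t ξ|)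
        ≤ ‖ξ‖ ^ k * (‖fourierInvS V ψ ξ‖ * |t|) := by gcongr
      _ = _ := by ring
  have hF : (𝓕 K).HasTemperateGrowth := by
    refine ⟨Real.contDiff_fourier fun n _ => hint n, fun n => ⟨0, ∫ ξ, ‖VectorFourier.fourierPowSMulRight (innerSL ℝ) K ξ n‖, fun w => ?_⟩⟩
    rw [Real.iteratedFDeriv_fourier (N := ⊤) (fun n _ => hint n) hKc.aestronglyMeasurable
      (by exact_mod_cast le_top), pow_zero, mul_one]
    exact VectorFourier.norm_fourierIntegral_le_integral_norm _ _ _ _ _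
  have heq : conv ψ (waveKernel t) = 𝓕 K ∘ (dilation V).symm := by
    ext x
    rw [Function.comp_apply, dilation_symm_apply, Real.fourier_eq', conv, waveKernel_apply,
      ← integral_neg_eq_self]
    congr 1
    ext ξ
    rw [fourierInvS_reflTranslate, neg_neg, inner_neg_left, real_inner_smul_right, smul_eq_mul, hK,
      mul_assoc]
    have h1 : waveSymbol t (-ξ) = waveSymbol t ξ := by simp [waveSymbol]
    rw [h1]
    congr 2
    have : (Real.pi : ℂ) ≠ 0 := by exact_mod_cast Real.pi_ne_zero
    push_cast
    field_simp
  rw [heq]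
  exact hF.comp (dilation V).symm.hasTemperateGrowth

theorem iterConv_hasTemperateGrowth (n : ℕ) (s : Fin n → ℝ) (φ : Fin n → 𝓢(V, ℂ)) :
    (iterConv n s φ).HasTemperateGrowth := by
  cases n with
  | zero => exact Function.HasTemperateGrowth.const 1
  | succ n => exact conv_waveKernel_hasTemperateGrowth _ _

/-- The Schwartz function that is convolved with `G(s_{n+1}, ·)` in `iterConv` is the pointwise
product `φ_{n+1} · φ_n(s_1, …, s_n, ·)`. -/
theorem iterConv_succ_factor (n : ℕ) (s : Fin n → ℝ) (φ : Fin n → 𝓢(V, ℂ)) (χ : 𝓢(V, ℂ)) (y : V) :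
    smulLeftCLM ℂ (iterConv n s φ) χ y = χ y * iterConv n s φ y := by
  rw [smulLeftCLM_apply_apply (iterConv_hasTemperateGrowth n s φ), smul_eq_mul, mul_comm]

end Wave

/-! ### Tensor products of Schwartz functions -/

section Tensor

variable {n d : ℕ}

/-- The `j`-th component `ξ_j ∈ ℝ^d` of a point `ξ = (ξ_1, …, ξ_n)` of `ℝ^{nd}`. -/
def block (j : Fin n) :
    EuclideanSpace ℝ (Fin n × Fin d) →L[ℝ] EuclideanSpace ℝ (Fin d) :=
  LinearMap.toContinuousLinearMap
    { toFun := fun ξ => WithLp.toLp 2 fun i => ξ (j, i)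
      map_add' := fun _ _ => rfl
      map_smul' := fun _ _ => rfl }

@[simp] theorem block_apply (j : Fin n) (ξ : EuclideanSpace ℝ (Fin n × Fin d)) (i : Fin d) :
    block j ξ i = ξ (j, i) := rfl

theorem norm_le_prod_block (ξ : EuclideanSpace ℝ (Fin n × Fin d)) :
    ‖ξ‖ ≤ ∏ j, (1 + ‖block j ξ‖) := by
  have h1 : ‖ξ‖ ^ 2 = ∑ j, ‖block j ξ‖ ^ 2 := by
    simp only [EuclideanSpace.norm_sq_eq, block_apply, Fintype.sum_prod_type]
  have h2 : ∀ s : Finset (Fin n), 1 + ∑ j ∈ s, ‖block j ξ‖ ^ 2 ≤ (∏ j ∈ s, (1 + ‖block j ξ‖)) ^ 2 := by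
    intro s
    induction s using Finset.induction_on with
    | empty => simp
    | insert a s ha ih =>
      rw [Finset.sum_insert ha, Finset.prod_insert ha, mul_pow]
      have h3 : 0 ≤ ∑ j ∈ s, ‖block j ξ‖ ^ 2 := Finset.sum_nonneg fun _ _ => by positivity
      have h4 := norm_nonneg (block a ξ)
      nlinarith [mul_nonneg h4 h3, mul_nonneg (sq_nonneg ‖block a ξ‖) h3,
        mul_le_mul_of_nonneg_left ih (sq_nonneg (1 + ‖block a ξ‖))]
  have h5 : 0 ≤ ∏ j, (1 + ‖block j ξ‖) := Finset.prod_nonneg fun _ _ => by positivity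
  refine abs_le_of_sq_le_sq' ?_ h5 |>.2
  have := h2 Finset.univ
  linarith

/-- The tensor product `φ_1 ⊗ ⋯ ⊗ φ_n`, the function
`(x_1, …, x_n) ↦ φ_1(x_1) ⋯ φ_n(x_n)` on `ℝ^{nd}`. -/
def tensor (φ : Fin n → 𝓢(EuclideanSpace ℝ (Fin d), ℂ)) :
    𝓢(EuclideanSpace ℝ (Fin n × Fin d), ℂ) where
  toFun := fun x => ∏ j, φ j (block j x)
  smooth' := contDiff_prod fun j _ => ((φ j).smooth ⊤).comp (block j).contDiff
  decay' := by
    intro k m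
    have hj (j : Fin n) (i : ℕ) : ∃ C : ℝ, 0 ≤ C ∧ ∀ x : EuclideanSpace ℝ (Fin n × Fin d),
        (1 + ‖block j x‖) ^ k * ‖iteratedFDeriv ℝ i (fun x => φ j (block j x)) x‖ ≤ C := by
      refine ⟨(2 ^ k * (Finset.Iic (k, i)).sup (fun m => SchwartzMap.seminorm ℝ m.1 m.2) (φ j)) *
        ‖(block j : EuclideanSpace ℝ (Fin n × Fin d) →L[ℝ] _)‖ ^ i, by positivity, fun x => ?_⟩
      have h1 := one_add_le_sup_seminorm_apply (𝕜 := ℝ) (m := (k, i)) le_rfl le_rfl (φ j) (block j x)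
      have h2 := (block j).iteratedFDeriv_comp_right (𝕜 := ℝ) ((φ j).smooth ⊤) x (i := i)
        (by exact_mod_cast le_top)
      have h3 : ‖iteratedFDeriv ℝ i (fun x => φ j (block j x)) x‖ ≤
          ‖iteratedFDeriv ℝ i (φ j) (block j x)‖ *
            ‖(block j : EuclideanSpace ℝ (Fin n × Fin d) →L[ℝ] _)‖ ^ i := by
        change ‖iteratedFDeriv ℝ i (φ j ∘ block j) x‖ ≤ _
        rw [h2]
        refine (ContinuousMultilinearMap.norm_compContinuousLinearMap_le _ _).trans ?_
        simp
      calc _ ≤ (1 + ‖block j x‖) ^ k * (‖iteratedFDeriv ℝ i (φ j) (block j x)‖ *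
            ‖(block j : EuclideanSpace ℝ (Fin n × Fin d) →L[ℝ] _)‖ ^ i) := by gcongr
        _ ≤ _ := by rw [← mul_assoc]; gcongr
    choose C hC0 hC using hj
    refine ⟨∑ p ∈ (Finset.univ : Finset (Fin n)).sym m, ((p : Multiset (Fin n)).countPerms : ℝ) *
      ∏ j, C j ((p : Multiset (Fin n)).count j), fun x => ?_⟩
    have h1 := norm_iteratedFDeriv_prod_le (𝕜 := ℝ) (u := Finset.univ) (n := m) (N := ∞)
      (f := fun (j : Fin n) (x : EuclideanSpace ℝ (Fin n × Fin d)) => φ j (block j x))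
      (fun j _ => ((φ j).smooth ⊤).comp (block j).contDiff) (x := x) (by exact_mod_cast le_top)
    have h2 : ‖x‖ ^ k ≤ ∏ j, (1 + ‖block j x‖) ^ k := by
      rw [Finset.prod_pow]
      exact pow_le_pow_left₀ (norm_nonneg _) (norm_le_prod_block x) k
    refine (mul_le_mul h2 h1 (norm_nonneg _)
      (Finset.prod_nonneg fun _ _ => by positivity)).trans ?_
    rw [Finset.mul_sum]
    refine Finset.sum_le_sum fun p _ => ?_
    rw [mul_left_comm, ← Finset.prod_mul_distrib]
    refine mul_le_mul_of_nonneg_left ?_ (by positivity)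
    exact Finset.prod_le_prod (fun _ _ => by positivity) fun j _ => hC j _ x

theorem tensor_apply (φ : Fin n → 𝓢(EuclideanSpace ℝ (Fin d), ℂ))
    (x : EuclideanSpace ℝ (Fin n × Fin d)) : tensor φ x = ∏ j, φ j (block j x) := rfl

end Tensor

/-! ### The kernels `f_n(t_1, ·, …, t_n, ·, t, x)` -/

section Kernel

variable {n d : ℕ}

/-- The increments `(t_2 - t_1, …, t_n - t_{n-1}, t - t_n)`. -/
def increments (τ : Fin n → ℝ) (t : ℝ) (j : Fin n) : ℝ :=
  (Fin.snoc τ t : Fin (n + 1) → ℝ) j.succ - τ j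

/-- The tempered distribution `f` on `ℝ^{nd}` is `f_n(t_1, ·, …, t_n, ·, t, x)`: its action on
`φ_1 ⊗ ⋯ ⊗ φ_n` is `φ_n(t_2 - t_1, …, t - t_n, x)`. -/
def IsKernel (τ : Fin n → ℝ) (t : ℝ) (x : EuclideanSpace ℝ (Fin d))
    (f : 𝓢'(EuclideanSpace ℝ (Fin n × Fin d), ℂ)) : Prop :=
  ∀ φ : Fin n → 𝓢(EuclideanSpace ℝ (Fin d), ℂ),
    f (tensor φ) = iterConv n (increments τ t) φ x

/-- The function
`e^{-i(ξ_1 + ⋯ + ξ_n)·x} ∏_j conj (𝓕G(t_{j+1} - t_j, ·)(ξ_1 + ⋯ + ξ_j))` on `ℝ^{nd}`,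
where `t_{n+1} = t`. -/
def kernelSymbol (τ : Fin n → ℝ) (t : ℝ) (x : EuclideanSpace ℝ (Fin d))
    (ξ : EuclideanSpace ℝ (Fin n × Fin d)) : ℂ :=
  Complex.exp (-(Complex.I * (inner ℝ (∑ j, block j ξ) x : ℝ))) *
    ∏ j, conj (waveSymbol (increments τ t j) (∑ i ∈ Finset.Iic j, block i ξ) : ℂ)

end Kernel

end StochWave

end

open StochWave

namespace StochWave

/-! ### The blocks of a point of `ℝ^{nd}` -/

/-! On the Fourier side, convolution with `G(s, ·)` is multiplication by `waveSymbol s`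
(`conv_waveKernel_eq`), and multiplication by `𝓕 h` is convolution with `h`
(`fourierInvS_eq_integral`). Take test functions `𝓕 h_1, …, 𝓕 h_n`. By induction the iterated
convolution is the Fourier transform of the image of the complex measure `waveDensity dξ` under `ξ ↦
ξ_1 + ⋯ + ξ_n`. At each stage, substituting `ζ = η + (ξ_1 + ⋯ + ξ_n)` (`integral_shear`) makes `η`
the new variable `ξ_{n+1}` and evaluates the new symbol at the next partial sum. The result is
`iterConv_fourierS`.

Both claims follow from this formula. The Fourier transform of a tensor product is a tensor product
(`fourierS_tensor`), so a kernel distribution tested on `𝓕 (h_1 ⊗ ⋯ ⊗ h_n)` gives the integral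
against `kernelSymbol`. For existence, `kernelSymbol` is bounded and continuous, hence is the
Fourier transform of a tempered distribution. The same formula with `h_j = 𝓕⁻¹ φ_j` shows that this
distribution acts on tensor products as required. -/

theorem volume_measurePreserving_uncurry {ι κ : Type*} [Fintype ι] [Fintype κ] :
    MeasurePreserving (MeasurableEquiv.curry ι κ ℝ).symm := by
  refine ⟨MeasurableEquiv.measurable _, ?_⟩
  rw [volume_pi (ι := ι × κ)]
  refine (Measure.pi_eq fun s hs => ?_).symm
  have hpre : (MeasurableEquiv.curry ι κ ℝ).symm ⁻¹' Set.univ.pi s =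
      Set.univ.pi fun i => Set.univ.pi fun k => s (i, k) := by
    ext f
    simp only [Set.mem_preimage, Set.mem_pi, Set.mem_univ, forall_true_left, Prod.forall]
    rfl
  rw [MeasurableEquiv.map_apply, hpre, volume_pi_pi]
  simp only [volume_pi_pi, Fintype.prod_prod_type]

section Blocks

variable {n d : ℕ}

theorem continuous_blocks :
    Continuous fun (ξ : EuclideanSpace ℝ (Fin n × Fin d)) (j : Fin n) => block j ξ :=
  continuous_pi fun j => (block j).continuous

theorem volume_measurePreserving_blocks :
    MeasurePreserving fun (ξ : EuclideanSpace ℝ (Fin n × Fin d)) (j : Fin n) => block j ξ :=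
  (volume_preserving_pi fun _ => PiLp.volume_preserving_toLp (Fin d)).comp
    ((volume_measurePreserving_uncurry.symm).comp (PiLp.volume_preserving_ofLp (Fin n × Fin d)))

theorem integral_comp_blocks (F : (Fin n → EuclideanSpace ℝ (Fin d)) → ℂ) :
    ∫ ξ : EuclideanSpace ℝ (Fin n × Fin d), F (fun j => block j ξ) = ∫ ζ, F ζ := by
  refine volume_measurePreserving_blocks.integral_comp ?_ F
  -- A continuous injection between these spaces is a measurable embedding, so `F` needs no
  -- regularity.
  refine continuous_blocks.measurableEmbedding fun ξ η h => ?_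
  ext ⟨j, i⟩
  exact congrArg (fun v : EuclideanSpace ℝ (Fin d) => v i) (congrFun h j)

theorem inner_eq_sum_block (ξ x : EuclideanSpace ℝ (Fin n × Fin d)) :
    inner ℝ ξ x = ∑ j, inner ℝ (block j ξ) (block j x) := by
  simp only [PiLp.inner_apply, block_apply, Fintype.sum_prod_type]

/-- The Fourier transform of a tensor product is the tensor product of the Fourier transforms. -/
theorem fourierS_tensor (φ : Fin n → 𝓢(EuclideanSpace ℝ (Fin d), ℂ)) :
    fourierS _ (tensor φ) = tensor fun j => fourierS _ (φ j) := by
  ext ξ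
  simp only [tensor_apply, fourierS_apply]
  rw [← integral_fintype_prod_volume_eq_prod
      (fun (j : Fin n) x => Complex.exp (-(Complex.I * (inner ℝ (block j ξ) x : ℝ))) * φ j x),
    ← integral_comp_blocks]
  refine integral_congr_ae (Filter.Eventually.of_forall fun x => ?_)
  simp only [inner_eq_sum_block, Finset.prod_mul_distrib, ← Complex.exp_sum, Complex.ofReal_sum,
    Finset.mul_sum, Finset.sum_neg_distrib]

theorem fourierInvS_tensor (φ : Fin n → 𝓢(EuclideanSpace ℝ (Fin d), ℂ)) :
    fourierInvS _ (tensor φ) = tensor fun j => fourierInvS _ (φ j) := by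
  conv_lhs => rw [← funext fun j => fourierS_fourierInvS (φ j)]
  rw [← fourierS_tensor, fourierInvS_fourierS]

/-! ### Continuity and boundedness of the symbol `K` -/

theorem continuous_kernelSymbol (τ : Fin n → ℝ) (t : ℝ) (x : EuclideanSpace ℝ (Fin d)) :
    Continuous (kernelSymbol τ t x) := by
  have hw (j : Fin n) := continuous_waveSymbol (V := EuclideanSpace ℝ (Fin d)) (increments τ t j)
  unfold kernelSymbol
  fun_prop

theorem norm_kernelSymbol_le (τ : Fin n → ℝ) (t : ℝ) (x : EuclideanSpace ℝ (Fin d))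
    (ξ : EuclideanSpace ℝ (Fin n × Fin d)) :
    ‖kernelSymbol τ t x ξ‖ ≤ ∏ j, |increments τ t j| := by
  rw [kernelSymbol, norm_mul, norm_prod, mul_comm Complex.I, ← neg_mul, ← Complex.ofReal_neg,
    Complex.norm_exp_ofReal_mul_I, one_mul]
  refine Finset.prod_le_prod (fun _ _ => norm_nonneg _) fun j _ => ?_
  rw [RCLike.norm_conj, Complex.norm_real]
  exact abs_waveSymbol_le _ _

theorem memLp_top_kernelSymbol (τ : Fin n → ℝ) (t : ℝ) (x : EuclideanSpace ℝ (Fin d)) :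
    MemLp (kernelSymbol τ t x) ⊤ (volume : Measure (EuclideanSpace ℝ (Fin n × Fin d))) :=
  memLp_top_of_bound (continuous_kernelSymbol τ t x).aestronglyMeasurable _
    (Filter.Eventually.of_forall (norm_kernelSymbol_le τ t x))

theorem integrable_mul_kernelSymbol (τ : Fin n → ℝ) (t : ℝ) (x : EuclideanSpace ℝ (Fin d))
    (H : 𝓢(EuclideanSpace ℝ (Fin n × Fin d), ℂ)) :
    Integrable fun ξ => H ξ * kernelSymbol τ t x ξ :=
  H.integrable.mul_bdd (continuous_kernelSymbol τ t x).aestronglyMeasurable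
    (Filter.Eventually.of_forall (norm_kernelSymbol_le τ t x))

end Blocks

/-! ### The iterated convolution in Fourier variables -/

section Density

variable {V : Type*} [NormedAddCommGroup V] [InnerProductSpace ℝ V]

/-- The density `∏_j h_j(ξ_j) 𝓕G(s_j, ·)(ξ_1 + ⋯ + ξ_j)`. -/
noncomputable def waveDensity (n : ℕ) (s : Fin n → ℝ) (h : Fin n → 𝓢(V, ℂ)) (ξ : Fin n → V) : ℂ :=
  (∏ j, h j (ξ j)) * ∏ j, (waveSymbol (s j) (∑ i ∈ Finset.Iic j, ξ i) : ℂ)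

variable {n : ℕ}

theorem continuous_waveDensity (s : Fin n → ℝ) (h : Fin n → 𝓢(V, ℂ)) :
    Continuous (waveDensity n s h) := by
  have hw (j : Fin n) := continuous_waveSymbol (V := V) (s j)
  have hh (j : Fin n) := (h j).continuous
  unfold waveDensity
  fun_prop

/-- Only the full sum sees the last variable; the earlier partial sums do not. This is the recursion
that drives the induction. -/
theorem waveDensity_snoc (s : Fin (n + 1) → ℝ) (h : Fin (n + 1) → 𝓢(V, ℂ)) (ξ : Fin n → V)
    (η : V) :
    waveDensity (n + 1) s h (Fin.snoc ξ η) =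
      waveDensity n (fun j => s j.castSucc) (fun j => h j.castSucc) ξ *
        (h (Fin.last n) η * waveSymbol (s (Fin.last n)) (η + ∑ i, ξ i)) := by
  have hI (j : Fin n) : ∑ i ∈ Finset.Iic j.castSucc, (Fin.snoc ξ η : Fin (n + 1) → V) i =
      ∑ i ∈ Finset.Iic j, ξ i := by
    rw [← Fin.map_castSuccEmb_Iic, Finset.sum_map]
    simp
  have hL : ∑ i ∈ Finset.Iic (Fin.last n), (Fin.snoc ξ η : Fin (n + 1) → V) i =
      η + ∑ i, ξ i := by
    rw [← Fin.top_eq_last, Finset.Iic_top, Fin.sum_univ_castSucc]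
    simp [add_comm]
  simp only [waveDensity, Fin.prod_univ_castSucc, hI, hL, Fin.snoc_castSucc, Fin.snoc_last]
  ring

end Density

/-! ### Fourier representation of the iterated convolution -/

section IterConv

variable {V : Type*} [NormedAddCommGroup V] [InnerProductSpace ℝ V] [FiniteDimensional ℝ V]
  [MeasurableSpace V] [BorelSpace V]

theorem norm_exp_I_mul_ofReal (r : ℝ) : ‖Complex.exp (Complex.I * r)‖ = 1 := by
  rw [mul_comm, Complex.norm_exp_ofReal_mul_I]

theorem norm_exp_neg_I_mul_ofReal (r : ℝ) : ‖Complex.exp (-(Complex.I * r))‖ = 1 := by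
  rw [← mul_neg, ← Complex.ofReal_neg, norm_exp_I_mul_ofReal]

/-- Reflection and translation become `ζ ↦ -ζ` and a phase under `𝓕⁻¹`; since the symbol is even,
changing the sign of the variable leaves `𝓕 (waveSymbol s · 𝓕⁻¹ ψ)`. -/
theorem conv_waveKernel_eq (ψ : 𝓢(V, ℂ)) (s : ℝ) (x : V) :
    conv ψ (waveKernel s) x =
      ∫ ζ, Complex.exp (-(Complex.I * (inner ℝ ζ x : ℝ))) * waveSymbol s ζ *
        fourierInvS V ψ ζ := by
  rw [conv, waveKernel_apply, ← integral_neg_eq_self]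
  congr 1
  ext ζ
  have h : waveSymbol s (-ζ) = waveSymbol s ζ := by simp [waveSymbol]
  rw [fourierInvS_reflTranslate, neg_neg, inner_neg_left, h]
  push_cast
  ring_nf

variable {n : ℕ}

theorem integrable_waveDensity (s : Fin n → ℝ) (h : Fin n → 𝓢(V, ℂ)) :
    Integrable (waveDensity n s h) := by
  have hw (j : Fin n) := continuous_waveSymbol (V := V) (s j)
  refine (Integrable.fintype_prod (f := fun j => h j) fun j => (h j).integrable).mul_bdd
    (c := ∏ j, |s j|) (Continuous.aestronglyMeasurable (by fun_prop))
    (Filter.Eventually.of_forall fun ξ => ?_)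
  rw [norm_prod]
  refine Finset.prod_le_prod (fun _ _ => norm_nonneg _) fun j _ => ?_
  rw [Complex.norm_real]
  exact abs_waveSymbol_le _ _

theorem integral_snoc (F : (Fin (n + 1) → V) → ℂ) :
    ∫ p : V × (Fin n → V), F (Fin.snoc p.2 p.1) = ∫ ξ, F ξ := by
  rw [← (volume_preserving_piFinSuccAbove (fun _ : Fin (n + 1) => V) (Fin.last n)).symm.integral_comp'
    F]
  congr 1
  ext p
  change _ = F (Fin.insertNth (Fin.last n) p.1 p.2)
  rw [Fin.insertNth_last']

/-- Fourier inversion of a Schwartz function times the Fourier transform of a finite measure with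
density `P`: it is the convolution of the two densities. -/
theorem fourierInvS_eq_integral {α : Type*} [MeasurableSpace α] {μ : Measure α} [SFinite μ]
    {P : α → ℂ} (hP : Integrable P μ) {σ : α → V} (hσ : Measurable σ) (h χ : 𝓢(V, ℂ))
    (hχ : ∀ y, χ y = fourierS V h y *
      ∫ a, Complex.exp (-(Complex.I * (inner ℝ (σ a) y : ℝ))) * P a ∂μ) (ζ : V) :
    fourierInvS V χ ζ = ∫ a, P a * h (ζ - σ a) ∂μ := by
  have hint : Integrable (fun p : V × α => Complex.exp (Complex.I * (inner ℝ (ζ - σ p.2) p.1 : ℝ)) *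
      (fourierS V h p.1 * P p.2)) (volume.prod μ) := by
    refine (Integrable.mul_prod ((fourierS V h).integrable (μ := volume)) hP).bdd_mul (c := 1) ?_
      (Filter.Eventually.of_forall fun p => (norm_exp_I_mul_ofReal _).le)
    refine Measurable.aestronglyMeasurable ?_
    fun_prop
  -- Inversion writes `h` itself as an integral of `𝓕 h`; it is recognized at `η = ζ - σ a` once
  -- Fubini has put the `y`-integral inside.
  have hinv (η : V) := fourierInvS_apply (fourierS V h) η
  simp only [fourierInvS_fourierS] at hinv
  rw [fourierInvS_apply]
  calc _ = ((2 * Real.pi) ^ Module.finrank ℝ V : ℝ)⁻¹ * ∫ y, ∫ a,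
        Complex.exp (Complex.I * (inner ℝ (ζ - σ a) y : ℝ)) * (fourierS V h y * P a) ∂μ := by
        congr 2
        ext y
        rw [hχ, ← mul_assoc, ← integral_const_mul]
        congr 1
        ext a
        rw [inner_sub_left, Complex.ofReal_sub, mul_sub, sub_eq_add_neg, Complex.exp_add]
        ring
    _ = _ := by
        rw [integral_integral_swap hint, ← integral_const_mul]
        congr 1
        ext a
        rw [hinv, mul_left_comm, ← integral_const_mul (P a)]
        congr 2
        ext y
        ring

/-- Fubini, and for each fixed `a` the translation `ζ ↦ ζ + σ a`. It turns the convolution variable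
into an independent one. -/
theorem integral_shear {α : Type*} [MeasurableSpace α] {μ : Measure α} [SFinite μ]
    {P : α → ℂ} (hP : Integrable P μ) {σ : α → V} (hσ : Measurable σ) (h : 𝓢(V, ℂ))
    {g : V → ℂ} (hg : Continuous g) {C : ℝ} (hC : ∀ ζ, ‖g ζ‖ ≤ C) :
    ∫ ζ, g ζ * ∫ a, P a * h (ζ - σ a) ∂μ =
      ∫ p : V × α, P p.2 * (h p.1 * g (p.1 + σ p.2)) ∂(volume.prod μ) := by
  have hint : Integrable (fun p : V × α => P p.2 * (h p.1 * g (p.1 + σ p.2))) (volume.prod μ) := by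
    have := (Integrable.mul_prod (h.integrable (μ := volume)) hP).mul_bdd (c := C)
      (g := fun p : V × α => g (p.1 + σ p.2))
      (hg.measurable.comp (by fun_prop)).aestronglyMeasurable
      (Filter.Eventually.of_forall fun p => hC _)
    refine this.congr (Filter.Eventually.of_forall fun p => ?_)
    ring
  -- The shear only transports integrability to the integrand before substitution. Skew products
  -- have the base as first factor, hence the two swaps.
  have hsh : MeasurePreserving (fun p : V × α => (p.1 - σ p.2, p.2)) (volume.prod μ)
      (volume.prod μ) := by
    have h1 : MeasurePreserving (fun p : α × V => (p.1, p.2 - σ p.1)) (μ.prod volume)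
        (μ.prod volume) :=
      (MeasurePreserving.id μ).skew_product (g := fun a v => v - σ a) (by fun_prop)
        (Filter.Eventually.of_forall fun a => (measurePreserving_sub_right volume (σ a)).map_eq)
    exact Measure.measurePreserving_swap.comp (h1.comp Measure.measurePreserving_swap)
  have hint' : Integrable (fun p : V × α => g p.1 * (P p.2 * h (p.1 - σ p.2)))
      (volume.prod μ) := by
    refine (hsh.integrable_comp_of_integrable hint).congr (Filter.Eventually.of_forall fun p => ?_)
    simp only [Function.comp_apply, sub_add_cancel]
    ring
  simp only [← integral_const_mul]
  rw [integral_integral_swap hint', integral_prod_symm _ hint]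
  congr 1
  ext a
  rw [← integral_sub_right_eq_self (fun ζ => P a * (h ζ * g (ζ + σ a))) (σ a)]
  congr 1
  ext ζ
  rw [sub_add_cancel]
  ring

/-- Induction on `n` with `x` free: the next factor involves the previous function at every point
`y`, not only at `x`. -/
theorem iterConv_fourierS (n : ℕ) (s : Fin n → ℝ) (h : Fin n → 𝓢(V, ℂ)) (x : V) :
    iterConv n s (fun j => fourierS V (h j)) x =
      ∫ ξ, Complex.exp (-(Complex.I * (inner ℝ (∑ j, ξ j) x : ℝ))) * waveDensity n s h ξ := by
  induction n generalizing x with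
  | zero => simp [iterConv, waveDensity, Measure.volume_pi_eq_dirac (0 : Fin 0 → V)]
  | succ n ih =>
    have hw := continuous_waveSymbol (V := V) (s (Fin.last n))
    rw [iterConv, conv_waveKernel_eq]
    -- The induction hypothesis supplies the factor required by `fourierInvS_eq_integral`, with
    -- density `waveDensity` and `σ` the total frequency.
    simp only [fourierInvS_eq_integral
      (integrable_waveDensity (fun j => s j.castSucc) (fun j => h j.castSucc))
      (σ := fun ξ : Fin n → V => ∑ j, ξ j) (by fun_prop) (h (Fin.last n)) _
      (fun y => by rw [iterConv_succ_factor, ih])]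
    -- Here `g` is the phase times the new symbol; the phase has modulus one, which gives the bound
    -- `C`.
    rw [integral_shear (C := |s (Fin.last n)|) (integrable_waveDensity _ _)
      (σ := fun ξ : Fin n → V => ∑ j, ξ j) (by fun_prop) _ (by fun_prop) ?_]
    · rw [← integral_snoc, Measure.volume_eq_prod]
      congr 1
      ext p
      rw [waveDensity_snoc, Fin.sum_univ_castSucc]
      simp only [Fin.snoc_castSucc, Fin.snoc_last, add_comm p.1]
      ring
    · intro ζ
      rw [norm_mul, norm_exp_neg_I_mul_ofReal, one_mul, Complex.norm_real]
      exact abs_waveSymbol_le _ _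

end IterConv

/-! ### The kernel distribution and its Fourier transform -/

theorem iterConv_increments_fourierS {n d : ℕ} (τ : Fin n → ℝ) (t : ℝ)
    (x : EuclideanSpace ℝ (Fin d)) (h : Fin n → 𝓢(EuclideanSpace ℝ (Fin d), ℂ)) :
    iterConv n (increments τ t) (fun j => fourierS _ (h j)) x =
      ∫ ξ, tensor h ξ * kernelSymbol τ t x ξ := by
  rw [iterConv_fourierS, ← integral_comp_blocks]
  congr 1
  ext ξ
  -- The conjugates disappear because the wave symbol is real.
  simp only [waveDensity, tensor_apply, kernelSymbol, Complex.conj_ofReal]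
  ring

end StochWave

theorem proposition2p1 (d n : ℕ) (hd : 1 ≤ d) (hn : 1 ≤ n) (τ : Fin n → ℝ) (t : ℝ)
    (hpos : ∀ j, 0 < τ j) (hmono : StrictMono τ) (hlt : ∀ j, τ j < t)
    (x : EuclideanSpace ℝ (Fin d)) :
    (∃ f : 𝓢'(EuclideanSpace ℝ (Fin n × Fin d), ℂ), IsKernel τ t x f ∧
      ∀ H : 𝓢(EuclideanSpace ℝ (Fin n × Fin d), ℂ),
        Integrable (fun ξ => H ξ * kernelSymbol τ t x ξ) ∧
        fourierDistrib f H = ∫ ξ, H ξ * kernelSymbol τ t x ξ) ∧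
    ∀ f : 𝓢'(EuclideanSpace ℝ (Fin n × Fin d), ℂ), IsKernel τ t x f →
      ∀ h : Fin n → 𝓢(EuclideanSpace ℝ (Fin d), ℂ), (∀ j, HasCompactSupport (h j)) →
        fourierDistrib f (tensor h) = ∫ ξ, tensor h ξ * kernelSymbol τ t x ξ := by
  refine ⟨⟨invFourierOfBounded _ (memLp_top_kernelSymbol τ t x), fun φ => ?_, fun H =>
    ⟨integrable_mul_kernelSymbol τ t x H, ?_⟩⟩, fun f hf h _ => ?_⟩
  -- Writing `φ_j = 𝓕 (𝓕⁻¹ φ_j)` brings arbitrary Schwartz test functions under the formula for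
  -- Fourier transforms.
  · rw [invFourierOfBounded_apply, fourierInvS_tensor, ← iterConv_increments_fourierS]
    simp only [fourierS_fourierInvS]
  · rw [fourierDistrib_apply, invFourierOfBounded_apply, fourierInvS_fourierS]
  · rw [fourierDistrib_apply, fourierS_tensor, hf, iterConv_increments_fourierS]
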